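/- **Setting.** Let $M$ be a smooth ($C^\infty$) Hausdorff, second countable manifold without boundary of finite dimension $n\ge 1$. Let $T^0M=M$, $T^{r+1}M=T(T^rM)$, and let $\pi_r\colon T^{r+1}M\to T^rM$ be the bundle projection; $D\phi$ is the tangent map of $\phi$, and $c'$ is the tangent of a curve $c$, a curve in the tangent bundle. For $r\ge 2$ let $\kappa_r\colon T^rM\to T^rM$ be the canonical involution, characterized by $\partial_t\partial_s c=\kappa_r\circ\partial_s\partial_t c$ for all smooth two-parameter maps $c$ into $T^{r-2}M$; in induced coordinates, $\kappa_r(x,y,X,Y)=(x,X,y,Y)$. Put $TM\setminus 0=\{y\in TM: y\ne 0\}$ and, for $r\ge 2$, $T^rM\setminus 0=\{\xi\in T^rM: (D\pi_{T^{r-1}M\to M})(\xi)\in TM\setminus 0\}$, where $\pi_{T^{r-1}M\to M}=\pi_0\circ\cdots\circ\pi_{r-2}$. A *spray* on $M$ is a smooth vector field $S$ on $TM\setminus 0$ with $D\pi_0\circ S=\mathrm{id}$ and $[E_1,S]=S$, where $E_1$ is the Liouville vector field of $TM$, $E_1(y)=\partial_s((1+s)y)|_{s=0}$. Its complete lift is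 $S^c=D\kappa_2\circ\kappa_3\circ DS\circ\kappa_2$, defined on $T^2M\setminus 0$, and its second complete lift is $S^{cc}=D\kappa_3\circ\kappa_4\circ DS^c\circ\kappa_3$, defined on $T^3M\setminus 0$. A *geodesic* of $S$ (respectively of $S^{cc}$) is a smooth curve $\gamma\colon I\to M$ (respectively $\gamma\colon I\to T^2M$), $I$ an open interval, with $\gamma'(t)\in TM\setminus 0$ (respectively $\gamma'(t)\in T^3M\setminus 0$) for all $t\in I$ and $\gamma''=S\circ\gamma'$ (respectively $\gamma''=S^{cc}\circ\gamma'$). A *parallel Jacobi field* of $S$ on $I$ is a curve $J\colon I\to TM$ of the form $J(t)=\alpha c'(t)+\beta t\,c'(t)$ with $\alpha,\beta\in\mathbb R$ and $c\colon I\to M$ a geodesic of $S$. Let $$\Delta=\{(\kappa_2\circ J')'(0): J\colon(-\varepsilon,\varepsilon)\to TM \text{ a parallel Jacobi field of } S,\ \varepsilon>0\}\subset T^3M .$$ A *geodesic in* $P=(S^{cc},TTM,\Delta)$ is a geodesic $\gamma\colon I\to TTM$ of $S^{cc}$ such that $\gamma'(t_0)\in\Delta$ for some $t_0\in I$. **Proposition.**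 Let $S$ be a spray on $M$. The projection $\pi_{TTM\to M}=\pi_0\circ\pi_1\colon TTM\to M$ is a smooth submersion, and for every geodesic $\gamma\colon I\to TTM$ in $P$ the curve $\pi_{TTM\to M}\circ\gamma\colon I\to M$ is a geodesic of $S$. -/

import Mathlib

open scoped Manifold ContDiff Topology

noncomputable section

namespace SubSpray

/-! ## Calculus on a smooth manifold `N` and on its iterated tangent bundles

The iterated tangent bundles of `N` are `TangentBundle J N`, `TangentBundle J.tangent (TangentBundle
J N)`, and so on. A point of `TangentBundle J N` is a pair `⟨p, v⟩`, where `v` is the coordinate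
vector of the tangent vector with respect to the preferred chart `chartAt H p` of `N` at `p`. The
preferred chart of `TangentBundle J N` at `⟨p, v⟩` is the one induced by `chartAt H p`. -/

section Manifold

variable {E : Type*} [NormedAddCommGroup E] [NormedSpace ℝ E]
  {H : Type*} [TopologicalSpace H] (J : ModelWithCorners ℝ E H)
  {N : Type*} [TopologicalSpace N] [ChartedSpace H N]

/-- The tangent `γ'` of a curve `γ` in `N`, as a curve in the tangent bundle of `N`. -/
def velocity (γ : ℝ → N) (t : ℝ) : TangentBundle J N :=
  ⟨γ t, mfderiv 𝓘(ℝ, ℝ) J γ t (1 : ℝ)⟩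

lemma velocity_eq {γ : ℝ → N} {t : ℝ} (h : MDifferentiableAt 𝓘(ℝ, ℝ) J γ t) :
    velocity J γ t = ⟨γ t, (show E from deriv (fun τ ↦ extChartAt J (γ t) (γ τ)) t)⟩ := by
  have h1 : mfderiv 𝓘(ℝ, ℝ) J γ t (1 : ℝ) =
      (show E from fderiv ℝ (fun τ ↦ extChartAt J (γ t) (γ τ)) t 1) := by
    have h2 := congrArg (fun L : ℝ →L[ℝ] E ↦ L 1) h.mfderiv
    simp only [writtenInExtChartAt, extChartAt_model_space_eq_id, PartialEquiv.refl_symm,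
      PartialEquiv.refl_coe, modelWithCornersSelf_coe, Set.range_id, fderivWithin_univ] at h2
    exact h2
  rw [velocity, h1, fderiv_apply_one_eq_deriv]

variable [IsManifold J ∞ N]

/-- The canonical involution `κ` of the second tangent bundle `TTN`. In the coordinates
`(x, y, X, Y)` of `TTN` induced by coordinates `x` of `N` it is `(x, y, X, Y) ↦ (x, X, y, Y)`.
At a point `⟨⟨x, y⟩, (X, Y)⟩` the vectors `y`, `X`, `Y` are the coordinates with respect to
the preferred chart at `x`. See `canonicalInvolution_mixed` for the property that characterizes
`κ`. -/
def canonicalInvolution (ξ : TangentBundle J.tangent (TangentBundle J N)) :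
    TangentBundle J.tangent (TangentBundle J N) :=
  ⟨⟨ξ.1.1, Prod.fst (α := E) (β := E) ξ.2⟩, ((ξ.1.2, Prod.snd (α := E) (β := E) ξ.2) : E × E)⟩

lemma trivializationAt_velocity {γ : ℝ → N} {t : ℝ} {x₀ : N}
    (h : MDifferentiableAt 𝓘(ℝ, ℝ) J γ t) (hx : γ t ∈ (chartAt H x₀).source) :
    (trivializationAt E (TangentSpace J) x₀ (velocity J γ t)).2 =
      deriv (fun τ ↦ extChartAt J x₀ (γ τ)) t := by
  have h1 := TangentBundle.continuousLinearMapAt_trivializationAt (I := J) (x₀ := x₀) hx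
  have h2 : (trivializationAt E (TangentSpace J) x₀ (velocity J γ t)).2 =
      (trivializationAt E (TangentSpace J) x₀).continuousLinearMapAt ℝ (γ t)
        (velocity J γ t).2 := by
    have := Bundle.Trivialization.linearMapAt_apply (R := ℝ)
      (trivializationAt E (TangentSpace J) x₀) (b := γ t) (mfderiv 𝓘(ℝ, ℝ) J γ t (1 : ℝ))
    rw [if_pos (by simpa using hx)] at this
    exact this.symm
  rw [h2, h1]
  have h3 := mfderiv_comp t (mdifferentiableAt_extChartAt (I := J) hx) h
  have h4 : deriv (fun τ ↦ extChartAt J x₀ (γ τ)) t =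
      mfderiv 𝓘(ℝ, ℝ) 𝓘(ℝ, E) (extChartAt J x₀ ∘ γ) t (1 : ℝ) := by
    rw [mfderiv_eq_fderiv]; rfl
  rw [h4, h3]
  rfl

lemma velocity_velocity {U : Set (ℝ × ℝ)} (hU : IsOpen U) {c : ℝ × ℝ → N}
    (hc : ContMDiffOn 𝓘(ℝ, ℝ × ℝ) J ∞ c U) (u v p : ℝ × ℝ) (t s : ℝ) (hp : p ∈ U)
    (hpdef : t • u + s • v = p) :
    velocity J.tangent (fun τ ↦ velocity J (fun σ ↦ c (τ • u + σ • v)) s) t =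
      (⟨⟨c p, (show E from fderiv ℝ (fun q ↦ extChartAt J (c p) (c q)) p v)⟩,
        (show E × E from (fderiv ℝ (fun q ↦ extChartAt J (c p) (c q)) p u,
          fderiv ℝ (fderiv ℝ (fun q ↦ extChartAt J (c p) (c q))) p u v))⟩ :
        TangentBundle J.tangent (TangentBundle J N)) := by
  set f : ℝ × ℝ → E := fun q ↦ extChartAt J (c p) (c q) with hf
  let W : Set (ℝ × ℝ) := U ∩ c ⁻¹' (chartAt H (c p)).source
  have hW : IsOpen W := hc.continuousOn.isOpen_inter_preimage hU (chartAt H (c p)).open_source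
  have hpW : p ∈ W := ⟨hp, mem_chart_source H (c p)⟩
  have hpW' : t • u + s • v ∈ W := hpdef ▸ hpW
  have hcW : ∀ q ∈ W, ContMDiffAt 𝓘(ℝ, ℝ × ℝ) J ∞ c q := fun q hq ↦
    (hc q hq.1).contMDiffAt (hU.mem_nhds hq.1)
  have hfW : ∀ q ∈ W, ContDiffAt ℝ ∞ f q := fun q hq ↦
    ((contMDiffAt_extChartAt' hq.2).comp q (hcW q hq)).contDiffAt
  -- the two affine curves
  have hl : ∀ τ σ : ℝ, HasDerivAt (fun σ : ℝ ↦ τ • u + σ • v) v σ := fun τ σ ↦ by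
    simpa using ((hasDerivAt_id σ).smul_const v).const_add (τ • u)
  have hm : ∀ τ σ : ℝ, HasDerivAt (fun τ : ℝ ↦ τ • u + σ • v) u τ := fun τ σ ↦ by
    simpa using ((hasDerivAt_id τ).smul_const u).add_const (σ • v)
  have hlc : ∀ τ σ : ℝ, τ • u + σ • v ∈ W →
      MDifferentiableAt 𝓘(ℝ, ℝ) J (fun σ ↦ c (τ • u + σ • v)) σ := fun τ σ h ↦
    MDifferentiableAt.comp (I' := 𝓘(ℝ, ℝ × ℝ)) σ ((hcW _ h).mdifferentiableAt (by simp))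
      (hl τ σ).differentiableAt.mdifferentiableAt
  have hmc : MDifferentiableAt 𝓘(ℝ, ℝ) J (fun τ ↦ c (τ • u + s • v)) t :=
    MDifferentiableAt.comp (I' := 𝓘(ℝ, ℝ × ℝ)) t ((hcW _ hpW').mdifferentiableAt (by simp))
      (hm t s).differentiableAt.mdifferentiableAt
  have hev : ∀ᶠ τ in 𝓝 t, τ • u + s • v ∈ W :=
    (hm t s).continuousAt.eventually_mem (hW.mem_nhds hpW')
  have hdl : ∀ τ, τ • u + s • v ∈ W →
      deriv (fun σ ↦ f (τ • u + σ • v)) s = fderiv ℝ f (τ • u + s • v) v := fun τ h ↦ by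
    have h1 := ((hfW _ h).differentiableAt (by simp)).hasFDerivAt
    exact (h1.comp_hasDerivAt s (hl τ s)).deriv
  have hin : velocity J (fun σ ↦ c (t • u + σ • v)) s = ⟨c p, (show E from fderiv ℝ f p v)⟩ := by
    have h1 := velocity_eq J (hlc t s hpW')
    have h2 := hdl t hpW'
    rw [hpdef] at h1 h2
    exact h1.trans (congrArg (fun w : E ↦ (⟨c p, w⟩ : TangentBundle J N)) h2)
  have htriv : (fun τ ↦ (trivializationAt E (TangentSpace J) (c p)
      (velocity J (fun σ ↦ c (τ • u + σ • v)) s)).2) =ᶠ[𝓝 t]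
      fun τ ↦ fderiv ℝ f (τ • u + s • v) v := by
    filter_upwards [hev] with τ h
    rw [trivializationAt_velocity J (hlc τ s h) h.2]
    exact hdl τ h
  have hff : DifferentiableAt ℝ (fderiv ℝ f) p :=
    ((hfW p hpW).fderiv_right (m := 1) (by norm_cast)).differentiableAt (by simp)
  have hff' : HasDerivAt (fun τ ↦ fderiv ℝ f (τ • u + s • v) v) (fderiv ℝ (fderiv ℝ f) p u v) t := by
    have h1 : HasFDerivAt (fderiv ℝ f) (fderiv ℝ (fderiv ℝ f) p) (t • u + s • v) := by
      rw [hpdef]; exact hff.hasFDerivAt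
    have h2 := h1.comp_hasDerivAt t (hm t s)
    exact (ContinuousLinearMap.apply ℝ E v).hasFDerivAt.comp_hasDerivAt t h2
  have hd : MDifferentiableAt 𝓘(ℝ, ℝ) J.tangent
      (fun τ ↦ velocity J (fun σ ↦ c (τ • u + σ • v)) s) t := by
    have h1 : MDifferentiableAt 𝓘(ℝ, ℝ) 𝓘(ℝ, E)
        (fun τ ↦ (trivializationAt E (TangentSpace J) (velocity J (fun σ ↦ c (t • u + σ • v)) s).proj
          (velocity J (fun σ ↦ c (τ • u + σ • v)) s)).2) t := by
      rw [hin]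
      exact (hff'.differentiableAt.congr_of_eventuallyEq htriv).mdifferentiableAt
    exact (mdifferentiableAt_totalSpace (F := E) (E := (TangentSpace J : N → Type _)) J
      (fun τ ↦ velocity J (fun σ ↦ c (τ • u + σ • v)) s)).2 ⟨hmc, h1⟩
  rw [velocity_eq J.tangent hd]
  have hE : deriv (fun τ ↦ extChartAt J.tangent (velocity J (fun σ ↦ c (t • u + σ • v)) s)
      (velocity J (fun σ ↦ c (τ • u + σ • v)) s)) t =
      ((fderiv ℝ f p u, fderiv ℝ (fderiv ℝ f) p u v) : E × E) := by
    rw [hin]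
    have h1 : HasDerivAt (fun τ ↦ f (τ • u + s • v)) (fderiv ℝ f p u) t := by
      have h0 : HasFDerivAt f (fderiv ℝ f p) (t • u + s • v) := by
        rw [hpdef]; exact ((hfW p hpW).differentiableAt (by simp)).hasFDerivAt
      exact h0.comp_hasDerivAt t (hm t s)
    refine ((h1.prodMk hff').congr_of_eventuallyEq ?_).deriv
    filter_upwards [htriv] with τ h
    rw [← h, FiberBundle.extChartAt]
    rfl
  rw [hE]
  exact congrArg (fun w : TangentBundle J N ↦
    (⟨w, (show E × E from (fderiv ℝ f p u, fderiv ℝ (fderiv ℝ f) p u v))⟩ :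
      TangentBundle J.tangent (TangentBundle J N))) hin

/-- The defining property of the canonical involution: `∂_t ∂_s c = κ (∂_s ∂_t c)`. -/
theorem canonicalInvolution_mixed {U : Set (ℝ × ℝ)} (hU : IsOpen U) {c : ℝ × ℝ → N}
    (hc : ContMDiffOn 𝓘(ℝ, ℝ × ℝ) J ∞ c U) {t s : ℝ} (hp : (t, s) ∈ U) :
    velocity J.tangent (fun τ ↦ velocity J (fun σ ↦ c (τ, σ)) s) t =
      canonicalInvolution J (velocity J.tangent (fun σ ↦ velocity J (fun τ ↦ c (τ, σ)) t) s) := by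
  have h1 := velocity_velocity J hU hc (1, 0) (0, 1) (t, s) t s hp (by simp)
  have h2 := velocity_velocity J hU hc (0, 1) (1, 0) (t, s) s t hp (by simp)
  simp only [Prod.smul_mk, smul_eq_mul, mul_one, mul_zero, Prod.mk_add_mk, add_zero, zero_add]
    at h1 h2
  have hs : IsSymmSndFDerivAt ℝ (fun q ↦ extChartAt J (c (t, s)) (c q)) (t, s) := by
    refine ContDiffAt.isSymmSndFDerivAt (n := ∞) ?_ (by simp; norm_cast)
    exact ((contMDiffAt_extChartAt' (mem_chart_source H _)).comp (t, s)
      ((hc _ hp).contMDiffAt (hU.mem_nhds hp))).contDiffAt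
  rw [h1, h2, hs.eq]
  rfl

/-- The Liouville vector field on `TN`, `(x, y) ↦ (x, y, 0, y)` in induced coordinates, that is,
the derivative at `s = 0` of `s ↦ (1 + s) y`. -/
def liouville (y : TangentBundle J N) : TangentSpace J.tangent y :=
  ((0, y.2) : E × E)

/-- A vector field on `TN`, as a map `TN → TTN`. -/
def toMap (S : ∀ y : TangentBundle J N, TangentSpace J.tangent y) (y : TangentBundle J N) :
    TangentBundle J.tangent (TangentBundle J N) :=
  ⟨y, S y⟩

/-- `E(y) = ∂_s ((1 + s) y)` at `s = 0`. -/
theorem velocity_smul (y : TangentBundle J N) :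
    velocity J.tangent (fun s ↦ (⟨y.1, (1 + s) • y.2⟩ : TangentBundle J N)) 0 =
      toMap J (liouville J) y := by
  obtain ⟨x, v⟩ := y
  have htriv : ∀ w : E, (trivializationAt E (TangentSpace J) x ⟨x, w⟩).2 = w := fun w ↦
    (tangentBundleCore J N).coordChange_self (achart H x) x (mem_chart_source H x) w
  have hv : HasDerivAt (fun s : ℝ ↦ (1 + s) • (show E from v)) (show E from v) 0 := by
    exact (((hasDerivAt_id (0 : ℝ)).const_add 1).smul_const (show E from v)).congr_deriv
      (one_smul ℝ _)
  have hd : MDifferentiableAt 𝓘(ℝ, ℝ) J.tangent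
      (fun s : ℝ ↦ (⟨x, (1 + s) • v⟩ : TangentBundle J N)) 0 := by
    refine (mdifferentiableAt_totalSpace (F := E) (E := (TangentSpace J : N → Type _)) J
      (fun s : ℝ ↦ (⟨x, (1 + s) • v⟩ : TangentBundle J N))).2 ⟨mdifferentiableAt_const, ?_⟩
    exact (hv.differentiableAt.congr_of_eventuallyEq
      (.of_forall fun s ↦ htriv ((1 + s) • (show E from v)))).mdifferentiableAt
  have hE : deriv (fun τ : ℝ ↦ extChartAt J.tangent (⟨x, (1 + (0 : ℝ)) • v⟩ : TangentBundle J N)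
      (⟨x, (1 + τ) • v⟩ : TangentBundle J N)) 0 = ((0, (show E from v)) : E × E) := by
    refine (((hasDerivAt_const (0 : ℝ) (extChartAt J x x)).prodMk hv).congr_of_eventuallyEq
      (.of_forall fun s ↦ ?_)).deriv
    rw [FiberBundle.extChartAt]
    exact Prod.ext rfl (htriv ((1 + s) • (show E from v)))
  rw [velocity_eq J.tangent hd, hE]
  have h1 : (1 + (0 : ℝ)) • v = v := by simp
  exact congrArg (fun w : E ↦ (⟨⟨x, w⟩, (show E × E from (0, (show E from v)))⟩ :
    TangentBundle J.tangent (TangentBundle J N))) h1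

/-- The complete lift `S^c = Dκ_N ∘ κ_{TN} ∘ DS ∘ κ_N : TTN → TTTN` of `S : TN → TTN`. -/
def completeLift
    (S : TangentBundle J N → TangentBundle J.tangent (TangentBundle J N))
    (ξ : TangentBundle J.tangent (TangentBundle J N)) :
    TangentBundle J.tangent.tangent (TangentBundle J.tangent (TangentBundle J N)) :=
  tangentMap J.tangent.tangent J.tangent.tangent (canonicalInvolution J (N := N))
    (canonicalInvolution J.tangent
      (tangentMap J.tangent J.tangent.tangent S (canonicalInvolution J ξ)))

/-- `γ` is, on the open interval `K`, a geodesic in `N` of the (semi)spray `S : TN → TTN`, where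
`A ⊆ TN` is the slashed tangent bundle on which `S` is defined: `γ` is smooth and regular
(its tangent stays in `A`) and `γ'' = S ∘ γ'`. Values of `γ` outside of `K` and of `S` outside of
`A` are irrelevant. -/
structure IsGeodesic (A : Set (TangentBundle J N))
    (S : TangentBundle J N → TangentBundle J.tangent (TangentBundle J N))
    (K : Set ℝ) (γ : ℝ → N) : Prop where
  isOpen : IsOpen K
  ordConnected : K.OrdConnected
  smooth : ContMDiffOn 𝓘(ℝ, ℝ) J ∞ γ K
  regular : ∀ t ∈ K, velocity J γ t ∈ A
  geodesic_eq : ∀ t ∈ K, velocity J.tangent (velocity J γ) t = S (velocity J γ t)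

/-- `γ` is, on the open interval `K`, a geodesic in the sub-spray `(S, N, Δ)`, `Δ ⊆ TN`: it is a
geodesic of `S`, and its tangent lies in `Δ` at some time. -/
structure IsGeodesicIn (A : Set (TangentBundle J N))
    (S : TangentBundle J N → TangentBundle J.tangent (TangentBundle J N))
    (Δ : Set (TangentBundle J N)) (K : Set ℝ) (γ : ℝ → N) : Prop where
  isGeodesic : IsGeodesic J A S K γ
  exists_mem : ∃ t₀ ∈ K, velocity J γ t₀ ∈ Δ

end Manifold

/-! ## Sprays on `M`, their second complete lift and the sub-spray `P` -/

section Spray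

variable {E : Type*} [NormedAddCommGroup E] [NormedSpace ℝ E]
  {H : Type*} [TopologicalSpace H] (I : ModelWithCorners ℝ E H)
  {M : Type*} [TopologicalSpace M] [ChartedSpace H M]

variable (M) in
/-- The slashed tangent bundle `TM ∖ {0}`. -/
def slashed : Set (TangentBundle I M) := {y | y.2 ≠ 0}

variable [IsManifold I ∞ M]

/-- The projection `TM → M`. -/
def proj₁ (y : TangentBundle I M) : M := y.1

/-- The projection `TTM → M`. -/
def proj₂ (ξ : TangentBundle I.tangent (TangentBundle I M)) : M := ξ.1.1

variable (M) in
/-- The slashed bundle `TTTM ∖ {0}`: all `ζ ∈ TTTM` whose image under `D (TTM → M)` is a nonzero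
vector of `TM`. -/
def slashed₃ :
    Set (TangentBundle I.tangent.tangent (TangentBundle I.tangent (TangentBundle I M))) :=
  {ζ | tangentMap I.tangent.tangent I (proj₂ I (M := M)) ζ ∈ slashed I M}

/-- `S` is a spray on `M`: a smooth vector field on `TM ∖ {0}` (its values on the zero section are
irrelevant) such that `D (TM → M) ∘ S = id` and `[E, S] = S` for the Liouville vector field `E`. -/
structure IsSpray (S : ∀ y : TangentBundle I M, TangentSpace I.tangent y) : Prop where
  smooth : ContMDiffOn I.tangent I.tangent.tangent ∞ (toMap I S) (slashed I M)
  tangentMap_proj : ∀ y ∈ slashed I M,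
    tangentMap I.tangent I (proj₁ I (M := M)) (toMap I S y) = y
  homogeneous : ∀ y ∈ slashed I M,
    VectorField.mlieBracket I.tangent (liouville I) S y = S y

variable (S : ∀ y : TangentBundle I M, TangentSpace I.tangent y)

/-- `j` is, on the open interval `K`, a parallel Jacobi field for `S`:
`j(t) = α c'(t) + β t c'(t)` for a geodesic `c` of `S` and constants `α`, `β`. -/
def IsParallelJacobi (K : Set ℝ) (j : ℝ → TangentBundle I M) : Prop :=
  ∃ (α β : ℝ) (c : ℝ → M), IsGeodesic I (slashed I M) (toMap I S) K c ∧
    ∀ t ∈ K, j t = ⟨c t, α • (velocity I c t).2 + (β * t) • (velocity I c t).2⟩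

/-- The phase space of `P`: all `(κ ∘ j')'(0) ∈ TTTM`, where `j : (-ε, ε) → TM` is a parallel
Jacobi field for `S`. -/
def phaseSpace :
    Set (TangentBundle I.tangent.tangent (TangentBundle I.tangent (TangentBundle I M))) :=
  {ζ | ∃ ε > 0, ∃ j : ℝ → TangentBundle I M, IsParallelJacobi I S (Set.Ioo (-ε) ε) j ∧
    ζ = velocity I.tangent.tangent
      (fun t ↦ canonicalInvolution I (velocity I.tangent j t)) 0}

/-- The second complete lift `S^{cc}` of `S`, a spray on `TTM`. -/
def secondCompleteLift :
    TangentBundle I.tangent.tangent (TangentBundle I.tangent (TangentBundle I M)) →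
    TangentBundle I.tangent.tangent.tangent
      (TangentBundle I.tangent.tangent (TangentBundle I.tangent (TangentBundle I M))) :=
  completeLift I.tangent (completeLift I (toMap I S))

/-- `γ : K → TTM` is a geodesic in the sub-spray `P = (S^{cc}, TTM, Δ)`, where `Δ` is the set
`phaseSpace I S`. -/
def IsGeodesicInP (K : Set ℝ) (γ : ℝ → TangentBundle I.tangent (TangentBundle I M)) : Prop :=
  IsGeodesicIn I.tangent.tangent (slashed₃ I M) (secondCompleteLift I S) (phaseSpace I S) K γ

end Spray

end SubSpray

end

namespace SubSpray

section Manifold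

variable {E : Type*} [NormedAddCommGroup E] [NormedSpace ℝ E]
  {H : Type*} [TopologicalSpace H] (J : ModelWithCorners ℝ E H)
  {N : Type*} [TopologicalSpace N] [ChartedSpace H N]
  {E' : Type*} [NormedAddCommGroup E'] [NormedSpace ℝ E']
  {H' : Type*} [TopologicalSpace H'] {J' : ModelWithCorners ℝ E' H'}
  {N' : Type*} [TopologicalSpace N'] [ChartedSpace H' N']

/-! Write `π : TN → N` for the projection. A complete lift is related to the original field by `DDπ
∘ S^c = S ∘ Dπ`. Since `κ` swaps `y` and `X`, `Dπ ∘ κ` is the projection `TTN → TN`, one level up.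
The chain rule then absorbs the outer `Dκ` and `κ` of `S^c`, and only the base point of `DS`
survives, which is the value of `S` (`tangentMap_tangentMap_proj₁_completeLift`).

Hence a geodesic `γ` of `S^c` satisfies `(π ∘ γ)'' = DDπ(γ'') = DDπ(S^c(γ')) = S(Dπ(γ')) = S((π ∘
γ)')`, and applying this twice passes from `S^{cc}` to `S`. The technical cost is the
differentiability of `κ` that the chain rule needs (`contMDiff_canonicalInvolution`): `κ` is defined
in a chart that varies with the point, so it must first be expressed in a fixed one. -/

lemma velocity_comp {f : N → N'} {γ : ℝ → N} {t : ℝ} (hf : MDifferentiableAt J J' f (γ t))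
    (hγ : MDifferentiableAt 𝓘(ℝ, ℝ) J γ t) :
    velocity J' (fun τ ↦ f (γ τ)) t = tangentMap J J' f (velocity J γ t) := by
  have h := mfderiv_comp_apply t hf hγ (1 : ℝ)
  exact congrArg (Bundle.TotalSpace.mk' E' (f (γ t))) h

lemma velocity_congr {γ η : ℝ → N} {t : ℝ} (h : γ =ᶠ[𝓝 t] η) :
    velocity J γ t = velocity J η t := by
  have h1 := h.mfderiv_eq (I := 𝓘(ℝ, ℝ)) (I' := J)
  have h0 := h.eq_of_nhds
  unfold velocity
  -- The fibre depends on the base point; with both derivatives viewed as maps into `E`, the two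
  -- equalities can be substituted separately.
  have : ∀ (p q : N) (L : ℝ →L[ℝ] E) (L' : ℝ →L[ℝ] E), p = q → L = L' →
      (⟨p, L 1⟩ : TangentBundle J N) = ⟨q, L' 1⟩ := by
    rintro p q L L' rfl rfl; rfl
  exact this _ _ _ _ h0 h1

variable [IsManifold J ∞ N]

/-! ### Induced charts of the tangent bundle and the derivative of its projection -/

lemma extChartAt_tangent_apply (y₀ y : TangentBundle J N) :
    extChartAt J.tangent y₀ y =
      (extChartAt J y₀.1 y.1, (trivializationAt E (TangentSpace J) y₀.1 y).2) := by
  rw [FiberBundle.extChartAt]; rfl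

lemma mem_extChartAt_tangent_target_iff {y₀ : TangentBundle J N} {p : E × E} :
    p ∈ (extChartAt J.tangent y₀).target ↔ p.1 ∈ (extChartAt J y₀.1).target := by
  rw [FiberBundle.extChartAt_target]
  simp only [Set.mem_prod, Set.mem_inter_iff, Set.mem_univ, and_true, Set.mem_preimage,
    TangentBundle.trivializationAt_baseSet, and_iff_left_iff_imp]
  intro h
  simpa using (extChartAt J y₀.1).map_target h

lemma mem_extChartAt_tangent_source_iff {y₀ y : TangentBundle J N} :
    y ∈ (extChartAt J.tangent y₀).source ↔ y.1 ∈ (extChartAt J y₀.1).source := by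
  rw [extChartAt_source, extChartAt_source, TangentBundle.mem_chart_source_iff]

lemma contMDiff_proj₁ : ContMDiff J.tangent J ∞ (proj₁ J (M := N)) :=
  Bundle.contMDiff_proj (TangentSpace J : N → Type _)

/-- In the preferred charts at `y` and `y.1` the projection is the linear map `(x, y) ↦ x`, which is
therefore its own derivative. -/
lemma tangentMap_proj₁ (ξ : TangentBundle J.tangent (TangentBundle J N)) :
    tangentMap J.tangent J (proj₁ J (M := N)) ξ =
      ⟨ξ.1.1, Prod.fst (α := E) (β := E) ξ.2⟩ := by
  obtain ⟨y, w⟩ := ξ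
  have h : HasMFDerivAt J.tangent J (proj₁ J (M := N)) y (ContinuousLinearMap.fst ℝ E E) := by
    refine ⟨(contMDiff_proj₁ J).continuous.continuousAt, ?_⟩
    refine ((ContinuousLinearMap.fst ℝ E E).hasFDerivWithinAt).congr_of_eventuallyEq ?_ ?_
    · filter_upwards [extChartAt_target_mem_nhdsWithin (I := J.tangent) y] with p hp
      have h1 := congrArg Prod.fst ((extChartAt J.tangent y).right_inv hp)
      rw [extChartAt_tangent_apply] at h1
      exact h1
    · have h1 := extChartAt_to_inv (I := J.tangent) y
      simp only [writtenInExtChartAt, Function.comp_apply, h1]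
      rw [extChartAt_tangent_apply]
      rfl
  exact congrArg (fun L : E × E →L[ℝ] E ↦ (⟨y.1, L w⟩ : TangentBundle J N)) h.mfderiv

lemma tangentMap_proj₁_canonicalInvolution (ξ : TangentBundle J.tangent (TangentBundle J N)) :
    tangentMap J.tangent J (proj₁ J (M := N)) (canonicalInvolution J ξ) = ξ.1 :=
  tangentMap_proj₁ J _

lemma mdifferentiableAt_velocity {γ : ℝ → N} {t : ℝ} (hγ : ContMDiffAt 𝓘(ℝ, ℝ) J ∞ γ t) :
    MDifferentiableAt 𝓘(ℝ, ℝ) J.tangent (velocity J γ) t := by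
  refine (mdifferentiableAt_totalSpace (F := E) (E := (TangentSpace J : N → Type _)) J
    (velocity J γ)).2 ⟨hγ.mdifferentiableAt (by simp), ?_⟩
  set f : ℝ → E := fun τ ↦ extChartAt J (γ t) (γ τ)
  have hf : ContDiffAt ℝ ∞ f t :=
    ((contMDiffAt_extChartAt' (mem_chart_source H (γ t))).comp t hγ).contDiffAt
  have hf' : DifferentiableAt ℝ (deriv f) t := by
    have := ((hf.fderiv_right (m := 1) (by norm_cast)).differentiableAt (by simp)).clm_apply
      (differentiableAt_const (1 : ℝ))
    exact this
  have hev : ∀ᶠ τ in 𝓝 t, γ τ ∈ (chartAt H (γ t)).source :=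
    hγ.continuousAt.eventually_mem ((chartAt H (γ t)).open_source.mem_nhds (mem_chart_source H _))
  -- `ContMDiffAt` of order `∞` at a point gives no single neighbourhood for all orders, but order
  -- `1` does spread to nearby points.
  have hev' : ∀ᶠ τ in 𝓝 t, MDifferentiableAt 𝓘(ℝ, ℝ) J γ τ := by
    have : IsManifold J 1 N := .of_le (n := ∞) (by norm_cast)
    filter_upwards [(contMDiffAt_iff_contMDiffAt_nhds (n := 1) (by simp)).1
      (hγ.of_le (by norm_cast))] with τ h
    exact h.mdifferentiableAt (by simp)
  refine (hf'.congr_of_eventuallyEq ?_).mdifferentiableAt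
  filter_upwards [hev, hev'] with τ h h'
  exact trivializationAt_velocity J h' h

/-! ### The canonical involution in induced coordinates -/

variable [J.Boundaryless]

lemma velocity_extChartAt_symm (y₀ : TangentBundle J N) {f : ℝ → E} {f' : E} {t : ℝ}
    (hf : HasDerivAt f f' t) (ht : f t ∈ (extChartAt J y₀.1).target) :
    velocity J (fun τ ↦ (extChartAt J y₀.1).symm (f τ)) t =
      (extChartAt J.tangent y₀).symm (f t, f') := by
  have hd : MDifferentiableAt 𝓘(ℝ, ℝ) J (fun τ ↦ (extChartAt J y₀.1).symm (f τ)) t := by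
    have h1 : ContMDiffAt 𝓘(ℝ, E) J ∞ (extChartAt J y₀.1).symm (f t) :=
      (contMDiffOn_extChartAt_symm y₀.1).contMDiffAt (extChartAt_target_mem_nhds' ht)
    exact (h1.mdifferentiableAt (by simp)).comp t hf.differentiableAt.mdifferentiableAt
  have hs : (extChartAt J y₀.1).symm (f t) ∈ (extChartAt J y₀.1).source :=
    (extChartAt J y₀.1).map_target ht
  have hp : (f t, f') ∈ (extChartAt J.tangent y₀).target :=
    (mem_extChartAt_tangent_target_iff J).2 ht
  refine (extChartAt J.tangent y₀).injOn ((mem_extChartAt_tangent_source_iff J).2 hs)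
    ((extChartAt J.tangent y₀).map_target hp) ?_
  rw [(extChartAt J.tangent y₀).right_inv hp, extChartAt_tangent_apply]
  refine Prod.ext ((extChartAt J y₀.1).right_inv ht) ?_
  refine (trivializationAt_velocity J hd (by simpa using hs)).trans ?_
  refine (hf.congr_of_eventuallyEq ?_).deriv
  filter_upwards [hf.continuousAt.eventually_mem (extChartAt_target_mem_nhds' ht)] with τ hτ
  exact (extChartAt J y₀.1).right_inv hτ

/-- Every point of `TTN` over the chart domain is thus the mixed velocity of an explicit coordinate
surface. This lets the symmetry of mixed derivatives describe `κ` in a fixed chart, with no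
computation of transition maps. -/
lemma velocity_velocity_extChartAt_symm (ξ₀ : TangentBundle J.tangent (TangentBundle J N))
    {x y X Y : E} (hx : x ∈ (extChartAt J ξ₀.1.1).target) :
    velocity J.tangent (fun τ : ℝ ↦ velocity J (fun σ : ℝ ↦
        (extChartAt J ξ₀.1.1).symm (x + σ • y + τ • (X + σ • Y))) 0) 0 =
      (extChartAt J.tangent.tangent ξ₀).symm ((x, y), (X, Y)) := by
  have hσ : ∀ τ : ℝ, HasDerivAt (fun σ : ℝ ↦ x + σ • y + τ • (X + σ • Y)) (y + τ • Y) 0 := by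
    intro τ
    have h1 := ((hasDerivAt_id (0 : ℝ)).smul_const y).const_add x
    have h2 := (((hasDerivAt_id (0 : ℝ)).smul_const Y).const_add X).const_smul τ
    exact (h1.add h2).congr_deriv (by simp)
  have hτ : HasDerivAt (fun τ : ℝ ↦ ((x + τ • X, y + τ • Y) : E × E)) (X, Y) 0 := by
    have h1 := ((hasDerivAt_id (0 : ℝ)).smul_const X).const_add x
    have h2 := ((hasDerivAt_id (0 : ℝ)).smul_const Y).const_add y
    simpa using h1.prodMk h2
  have hev : ∀ᶠ τ : ℝ in 𝓝 0, x + τ • X ∈ (extChartAt J ξ₀.1.1).target := by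
    have h1 : ContinuousAt (fun τ : ℝ ↦ x + τ • X) 0 := by fun_prop
    refine h1.eventually_mem ?_
    simpa using extChartAt_target_mem_nhds' hx
  have h1 : (fun τ : ℝ ↦ velocity J (fun σ : ℝ ↦
        (extChartAt J ξ₀.1.1).symm (x + σ • y + τ • (X + σ • Y))) 0) =ᶠ[𝓝 0]
      fun τ ↦ (extChartAt J.tangent ξ₀.1).symm (x + τ • X, y + τ • Y) := by
    filter_upwards [hev] with τ h
    have := velocity_extChartAt_symm J ξ₀.1 (hσ τ) (by simpa using h)
    simpa using this
  rw [velocity_congr J.tangent h1]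
  have h2 := velocity_extChartAt_symm J.tangent ξ₀ hτ
    ((mem_extChartAt_tangent_target_iff J).2 (by simpa using hx))
  simpa using h2

/-- The canonical involution in induced coordinates. -/
lemma canonicalInvolution_extChartAt_symm
    (ξ₀ : TangentBundle J.tangent (TangentBundle J N))
    {x y X Y : E} (hx : x ∈ (extChartAt J ξ₀.1.1).target) :
    canonicalInvolution J ((extChartAt J.tangent.tangent ξ₀).symm ((x, y), (X, Y))) =
      (extChartAt J.tangent.tangent (canonicalInvolution J ξ₀)).symm ((x, X), (y, Y)) := by
  let g : ℝ × ℝ → E := fun p ↦ x + p.1 • y + p.2 • (X + p.1 • Y)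
  have hg : ContDiff ℝ ∞ g := by fun_prop
  let U : Set (ℝ × ℝ) := g ⁻¹' (extChartAt J ξ₀.1.1).target
  have hU : IsOpen U := (isOpen_extChartAt_target ξ₀.1.1).preimage hg.continuous
  have hc : ContMDiffOn 𝓘(ℝ, ℝ × ℝ) J ∞ (fun p ↦ (extChartAt J ξ₀.1.1).symm (g p)) U :=
    (contMDiffOn_extChartAt_symm ξ₀.1.1).comp hg.contMDiff.contMDiffOn fun _ h ↦ h
  have h0 : ((0 : ℝ), (0 : ℝ)) ∈ U := by simpa [U, g] using hx
  have h1 := canonicalInvolution_mixed J hU hc h0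
  have h2 := velocity_velocity_extChartAt_symm J ξ₀ (y := y) (X := X) (Y := Y) hx
  have h3 := velocity_velocity_extChartAt_symm J (canonicalInvolution J ξ₀)
    (y := X) (X := y) (Y := Y) hx
  -- Exchanging `y` with `X` and the two parameters leaves the surface unchanged, so both sides are
  -- mixed velocities of one map, taken in opposite orders.
  have h4 : ∀ σ τ : ℝ, x + σ • X + τ • (y + σ • Y) = g (τ, σ) := by
    intro σ τ
    simp only [g, smul_add, smul_comm σ τ]
    abel
  simp only [h4] at h3
  rw [← h2, ← h3]
  exact h1.symm

lemma contMDiff_canonicalInvolution :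
    ContMDiff J.tangent.tangent J.tangent.tangent ∞ (canonicalInvolution J (N := N)) := by
  intro ξ₀
  let s : (E × E) × (E × E) → (E × E) × (E × E) := fun p ↦ ((p.1.1, p.2.1), (p.1.2, p.2.2))
  have hs : ContDiff ℝ ∞ s := by fun_prop
  have hmem : ∀ {ξ}, ξ ∈ (extChartAt J.tangent.tangent ξ₀).source →
      (extChartAt J.tangent.tangent ξ₀ ξ).1.1 ∈ (extChartAt J ξ₀.1.1).target := fun h ↦
    (mem_extChartAt_tangent_target_iff J).1 ((mem_extChartAt_tangent_target_iff J.tangent).1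
      ((extChartAt J.tangent.tangent ξ₀).map_source h))
  have h0 : s (extChartAt J.tangent.tangent ξ₀ ξ₀) ∈
      (extChartAt J.tangent.tangent (canonicalInvolution J ξ₀)).target :=
    -- Membership in the target constrains only the coordinate `x`, which the swap `s` fixes.
    (mem_extChartAt_tangent_target_iff J.tangent).2 ((mem_extChartAt_tangent_target_iff J).2
      (hmem (mem_extChartAt_source ξ₀)))
  have h1 : ContMDiffAt 𝓘(ℝ, (E × E) × (E × E)) J.tangent.tangent ∞
      (extChartAt J.tangent.tangent (canonicalInvolution J ξ₀)).symm
      (s (extChartAt J.tangent.tangent ξ₀ ξ₀)) :=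
    (contMDiffOn_extChartAt_symm _).contMDiffAt (extChartAt_target_mem_nhds' h0)
  have h2 : ContMDiffAt J.tangent.tangent 𝓘(ℝ, (E × E) × (E × E)) ∞
      (fun ξ ↦ s (extChartAt J.tangent.tangent ξ₀ ξ)) ξ₀ :=
    hs.contMDiff.contMDiffAt.comp ξ₀ contMDiffAt_extChartAt
  refine (h1.comp ξ₀ h2).congr_of_eventuallyEq ?_
  filter_upwards [extChartAt_source_mem_nhds (I := J.tangent.tangent) ξ₀] with ξ hξ
  have h3 := canonicalInvolution_extChartAt_symm J ξ₀
    (y := (extChartAt J.tangent.tangent ξ₀ ξ).1.2)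
    (X := (extChartAt J.tangent.tangent ξ₀ ξ).2.1)
    (Y := (extChartAt J.tangent.tangent ξ₀ ξ).2.2) (hmem hξ)
  exact (congrArg (canonicalInvolution J)
    ((extChartAt J.tangent.tangent ξ₀).left_inv hξ)).symm.trans h3

/-! ### Projecting geodesics of a complete lift -/

/-- The complete lift of `S` is related to `S` by the tangent map of the projection `TN → N`. -/
lemma tangentMap_tangentMap_proj₁_completeLift
    (S : TangentBundle J N → TangentBundle J.tangent (TangentBundle J N))
    (ξ : TangentBundle J.tangent (TangentBundle J N)) :
    tangentMap J.tangent.tangent J.tangent (tangentMap J.tangent J (proj₁ J (M := N)))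
        (completeLift J S ξ) = S (tangentMap J.tangent J (proj₁ J (M := N)) ξ) := by
  have hP : ContMDiff J.tangent.tangent J.tangent ∞ (tangentMap J.tangent J (proj₁ J (M := N))) :=
    (contMDiff_proj₁ J).contMDiff_tangentMap (by norm_cast)
  have hc : tangentMap J.tangent J (proj₁ J (M := N)) ∘ canonicalInvolution J =
      proj₁ J.tangent (M := TangentBundle J N) :=
    funext (tangentMap_proj₁_canonicalInvolution J)
  rw [completeLift, ← tangentMap_comp_at _ (hP.mdifferentiable (by simp) _)
    ((contMDiff_canonicalInvolution J).mdifferentiable (by simp) _), hc,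
    tangentMap_proj₁_canonicalInvolution, tangentMap_proj₁]
  rfl

/-- The projection to `N` of a geodesic of the complete lift of `S` is a geodesic of `S`. -/
lemma IsGeodesic.proj₁ {A : Set (TangentBundle J.tangent (TangentBundle J N))}
    {B : Set (TangentBundle J N)}
    {S : TangentBundle J N → TangentBundle J.tangent (TangentBundle J N)}
    {K : Set ℝ} {γ : ℝ → TangentBundle J N}
    (hγ : IsGeodesic J.tangent A (completeLift J S) K γ)
    (hAB : Set.MapsTo (tangentMap J.tangent J (SubSpray.proj₁ J (M := N))) A B) :
    IsGeodesic J B S K (fun t ↦ SubSpray.proj₁ J (γ t)) := by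
  have hat : ∀ t ∈ K, ContMDiffAt 𝓘(ℝ, ℝ) J.tangent ∞ γ t := fun t ht ↦
    hγ.smooth.contMDiffAt (hγ.isOpen.mem_nhds ht)
  have hv : ∀ t ∈ K, velocity J (fun t ↦ SubSpray.proj₁ J (γ t)) t =
      tangentMap J.tangent J (SubSpray.proj₁ J (M := N)) (velocity J.tangent γ t) := fun t ht ↦
    velocity_comp J.tangent ((contMDiff_proj₁ J).mdifferentiable (by simp) _)
      ((hat t ht).mdifferentiableAt (by simp))
  have hP : ContMDiff J.tangent.tangent J.tangent ∞
      (tangentMap J.tangent J (SubSpray.proj₁ J (M := N))) :=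
    (contMDiff_proj₁ J).contMDiff_tangentMap (by norm_cast)
  refine ⟨hγ.isOpen, hγ.ordConnected, (contMDiff_proj₁ J).comp_contMDiffOn hγ.smooth,
    fun t ht ↦ hv t ht ▸ hAB (hγ.regular t ht), fun t ht ↦ ?_⟩
  -- The second velocity differentiates the first, so the identity `hv` is needed on a neighbourhood
  -- of `t`.
  have h1 : velocity J (fun t ↦ SubSpray.proj₁ J (γ t)) =ᶠ[𝓝 t]
      fun t ↦ tangentMap J.tangent J (SubSpray.proj₁ J (M := N)) (velocity J.tangent γ t) := by
    filter_upwards [hγ.isOpen.mem_nhds ht] with τ hτ using hv τ hτ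
  rw [velocity_congr J.tangent h1, velocity_comp J.tangent.tangent
    (hP.mdifferentiable (by simp) _) (mdifferentiableAt_velocity J.tangent (hat t ht)),
    hγ.geodesic_eq t ht, tangentMap_tangentMap_proj₁_completeLift, hv t ht]

end Manifold

/-! ### The projection from the second tangent bundle to the base -/

section Spray

variable {E : Type*} [NormedAddCommGroup E] [NormedSpace ℝ E]
  {H : Type*} [TopologicalSpace H] (I : ModelWithCorners ℝ E H)
  {M : Type*} [TopologicalSpace M] [ChartedSpace H M] [IsManifold I ∞ M]

/-- In induced charts the map is `(x, y, X, Y) ↦ x`; the complement `E × (E × E)` collects `y` and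
`(X, Y)`. -/
lemma isSubmersion_proj₂ :
    Manifold.IsSubmersion I.tangent.tangent I ∞ (proj₂ I (M := M)) := by
  refine ⟨E × (E × E), inferInstance, inferInstance, fun ξ ↦ ?_⟩
  refine Manifold.IsSubmersionAtOfComplement.mk_of_charts
    (ContinuousLinearEquiv.prodAssoc ℝ E E (E × E)) (chartAt _ ξ) (chartAt H ξ.1.1)
    (mem_chart_source _ ξ) (mem_chart_source _ ξ.1.1)
    (IsManifold.chart_mem_maximalAtlas ξ) (IsManifold.chart_mem_maximalAtlas ξ.1.1) ?_ ?_
  · intro η hη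
    exact (TangentBundle.mem_chart_source_iff _ _).1 ((TangentBundle.mem_chart_source_iff _ _).1 hη)
  · intro p hp
    have h1 := congrArg (fun q : (E × E) × (E × E) ↦ q.1.1)
      ((extChartAt I.tangent.tangent ξ).right_inv hp)
    simp only [extChartAt_tangent_apply] at h1
    exact h1

/-- The chain rule for `TTM → TM → M`. The preimage on the right is the intermediate slashed bundle
of `TTM`, where the once-projected geodesic must be regular. -/
lemma mapsTo_tangentMap_proj₁_slashed₃ :
    Set.MapsTo (tangentMap I.tangent.tangent I.tangent (proj₁ I.tangent (M := TangentBundle I M)))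
      (slashed₃ I M) (tangentMap I.tangent I (proj₁ I (M := M)) ⁻¹' slashed I M) := by
  intro ζ hζ
  have h : proj₂ I (M := M) = proj₁ I ∘ proj₁ I.tangent (M := TangentBundle I M) := rfl
  rw [slashed₃, Set.mem_ofPred_eq, h, tangentMap_comp_at _
    ((contMDiff_proj₁ I).mdifferentiable (by simp) _)
    ((contMDiff_proj₁ I.tangent).mdifferentiable (by simp) _)] at hζ
  exact hζ

/-- Geodesics of the second complete lift of `S` project to geodesics of `S`. -/
lemma IsGeodesic.proj₂ [I.Boundaryless] {S : ∀ y : TangentBundle I M, TangentSpace I.tangent y}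
    {K : Set ℝ} {γ : ℝ → TangentBundle I.tangent (TangentBundle I M)}
    (hγ : IsGeodesic I.tangent.tangent (slashed₃ I M) (secondCompleteLift I S) K γ) :
    IsGeodesic I (slashed I M) (toMap I S) K (fun t ↦ SubSpray.proj₂ I (γ t)) :=
  (IsGeodesic.proj₁ I.tangent hγ (mapsTo_tangentMap_proj₁_slashed₃ I)).proj₁ I
    (Set.mapsTo_preimage _ _)

end Spray

end SubSpray

theorem mainTheorem5 (n : ℕ) (hn : 1 ≤ n) {M : Type*} [TopologicalSpace M]
    [ChartedSpace (EuclideanSpace ℝ (Fin n)) M] [IsManifold (𝓡 n) ∞ M]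
    [T2Space M] [SecondCountableTopology M]
    (S : ∀ y : TangentBundle (𝓡 n) M, TangentSpace (𝓡 n).tangent y)
    (hS : SubSpray.IsSpray (𝓡 n) S) :
    Manifold.IsSubmersion (𝓡 n).tangent.tangent (𝓡 n) ∞ (SubSpray.proj₂ (𝓡 n) (M := M)) ∧
    ∀ (K : Set ℝ) (γ : ℝ → TangentBundle (𝓡 n).tangent (TangentBundle (𝓡 n) M)),
      SubSpray.IsGeodesicInP (𝓡 n) S K γ →
      SubSpray.IsGeodesic (𝓡 n) (SubSpray.slashed (𝓡 n) M) (SubSpray.toMap (𝓡 n) S) K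
        (fun t ↦ SubSpray.proj₂ (𝓡 n) (γ t)) :=
  ⟨SubSpray.isSubmersion_proj₂ (𝓡 n), fun _ _ hγ ↦ hγ.isGeodesic.proj₂ (𝓡 n)⟩
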